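/- **Theorem (asymptotic convergence of softmax policy gradient).** Let $M$ be a finite Markov decision process with finite state space $\mathcal S$, finite nonempty action space $\mathcal A$, transition probabilities $P(s'\mid s,a)$, rewards $r(s,a)\in[0,1]$ and discount factor $\gamma\in[0,1)$. For a stationary stochastic policy $\pi:\mathcal S\to\Delta(\mathcal A)$ let $$V^\pi(s)=\mathbb E\Big[\sum_{t\ge 0}\gamma^t r(s_t,a_t)\,\Big|\,s_0=s,\ a_t\sim\pi(\cdot\mid s_t),\ s_{t+1}\sim P(\cdot\mid s_t,a_t)\Big],\qquad V^\pi(\mu)=\sum_{s}\mu(s)V^\pi(s).$$ Call $\pi^\star$ optimal if $V^{\pi}(s)\le V^{\pi^\star}(s)$ for all policies $\pi$ and all states $s$. For $\theta\in\mathbb R^{\mathcal S\times\mathcal A}$ let $\pi_\theta(a\mid s)=\exp(\theta_{s,a})/\sum_{a'}\exp(\theta_{s,a'})$ be the softmax policy. Let $\mu$ be a distribution on $\mathcal S$ with $\mu(s)>0$ for all $s$, let $0<\eta\le (1-\gamma)^2/5$, let $\theta^{(0)}\in\mathbb R^{\mathcal S\times\mathcal A}$ be arbitrary, and let $$\theta^{(t+1)}=\theta^{(t)}+\eta\,\nabla_\theta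 V^{\pi_\theta}(\mu)\big|_{\theta=\theta^{(t)}},\qquad t=0,1,2,\dots$$ Then there is a deterministic optimal policy, and, writing $V^\star=V^{\pi^\star}$ for the common value function of the optimal policies $\pi^\star$, $$V^{\pi_{\theta^{(t)}}}(s)\to V^\star(s)\quad\text{as }t\to\infty,\qquad\text{for every state } s\in\mathcal S.$$ This holds although, when $|\mathcal A|\ge 2$, a deterministic optimal policy $\pi^\star$ is only reached with parameters going to infinity: no $\theta$ satisfies $\pi_\theta=\pi^\star$; there are sequences $(\vartheta_n)$ with $\pi_{\vartheta_n}\to\pi^\star$; and every such sequence satisfies $\|\vartheta_n\|\to\infty$. -/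

import Mathlib

open Set Filter MeasureTheory ProbabilityTheory
open scoped Topology Gradient

noncomputable section

/-- A finite Markov decision process with state space `S` and action space `A` (finite types):
transition probabilities `P s a : Δ(S)`, rewards `r s a ∈ [0,1]`, discount factor `γ ∈ [0,1)`.
The start distribution is kept separate from the structure. -/
structure FiniteMDP (S A : Type*) [Fintype S] [Fintype A] where
  /-- `P s a s'` is the probability of moving to `s'` when action `a` is taken in state `s`. -/
  P : S → A → stdSimplex ℝ S
  /-- The immediate reward. -/
  r : S → A → ℝ
  /-- The discount factor. -/
  γ : ℝ
  r_mem : ∀ s a, r s a ∈ Set.Icc (0 : ℝ) 1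
  γ_mem : γ ∈ Set.Ico (0 : ℝ) 1

/-- A stationary stochastic policy `π : S → Δ(A)`; `π s a` is the probability `π(a|s)`. -/
abbrev StochPolicy (S A : Type*) [Fintype A] := S → stdSimplex ℝ A

/-- The probability measure on a finite type given by a probability vector. -/
def simplexMeasure {X : Type*} [Fintype X] [MeasurableSpace X] (p : stdSimplex ℝ X) : Measure X :=
  ∑ x, ENNReal.ofReal (p x) • Measure.dirac x

instance isProbabilityMeasure_simplexMeasure {X : Type*} [Fintype X] [MeasurableSpace X] (p : stdSimplex ℝ X) :
    IsProbabilityMeasure (simplexMeasure p) := by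
  constructor
  have h : ∑ x, ENNReal.ofReal (p x) = 1 := by
    have h0 : ∀ x ∈ Finset.univ, 0 ≤ p x := fun x _ => p.2.1 x
    have h1 : ∑ x, p x = 1 := p.2.2
    rw [← ENNReal.ofReal_sum_of_nonneg h0, h1, ENNReal.ofReal_one]
  simp [simplexMeasure, h]

/-- The joint law of `(s, a)` when `s ∼ p` and then `a ∼ π(·|s)`. -/
def jointLaw {S A : Type*} [Fintype S] [Fintype A] (p : stdSimplex ℝ S) (π : StochPolicy S A) :
    stdSimplex ℝ (S × A) :=
  ⟨fun x => p x.1 * π x.1 x.2, fun x => mul_nonneg (p.2.1 x.1) ((π x.1).2.1 x.2), by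
    rw [Fintype.sum_prod_type]
    have h : ∀ s, ∑ a, π s a = 1 := fun s => (π s).2.2
    simp only [← Finset.mul_sum, h, mul_one]
    exact p.2.2⟩

/-- A deterministic policy, seen as a stochastic one, puts all its mass on one action. -/
def StochPolicy.IsDeterministic {S A : Type*} [Fintype A] (π : StochPolicy S A) : Prop :=
  ∃ f : S → A, ∀ s, π s (f s) = 1

/-- The softmax policy `π_θ(a|s) = exp θ_{s,a} / ∑_{a'} exp θ_{s,a'}`. -/
def softmaxPolicy {S A : Type*} [Fintype A] [Nonempty A] (θ : EuclideanSpace ℝ (S × A)) :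
    StochPolicy S A := fun s =>
  ⟨fun a => Real.exp (θ (s, a)) / ∑ a', Real.exp (θ (s, a')),
    fun a => by positivity, by
      have h : 0 < ∑ a', Real.exp (θ (s, a')) :=
        Finset.sum_pos (fun a' _ => Real.exp_pos _) Finset.univ_nonempty
      rw [← Finset.sum_div, div_self h.ne']⟩

namespace FiniteMDP

variable {S A : Type*} [Fintype S] [Fintype A] [MeasurableSpace S] [DiscreteMeasurableSpace S]
  [MeasurableSpace A] [DiscreteMeasurableSpace A]

/-- One step of the state-action chain under `π`: from `(s, a)`, draw `s' ∼ P(·|s,a)` and then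
`a' ∼ π(·|s')`. -/
def stepKernel (M : FiniteMDP S A) (π : StochPolicy S A) : Kernel (S × A) (S × A) where
  toFun x := simplexMeasure (jointLaw (M.P x.1 x.2) π)
  measurable' := Measurable.of_discrete

instance isMarkovKernel_stepKernel (M : FiniteMDP S A) (π : StochPolicy S A) :
    IsMarkovKernel (M.stepKernel π) :=
  ⟨fun _ => inferInstanceAs (IsProbabilityMeasure (simplexMeasure _))⟩

/-- The step kernel as a kernel on histories `(s_0,a_0), …, (s_n,a_n)`; only the last
state-action pair matters. -/
def historyKernel (M : FiniteMDP S A) (π : StochPolicy S A) (n : ℕ) :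
    Kernel ((_ : Finset.Iic n) → S × A) (S × A) :=
  (M.stepKernel π).comap (fun h => h ⟨n, Finset.mem_Iic.2 le_rfl⟩) (measurable_pi_apply _)

instance isMarkovKernel_historyKernel (M : FiniteMDP S A) (π : StochPolicy S A) (n : ℕ) :
    IsMarkovKernel (M.historyKernel π n) :=
  inferInstanceAs (IsMarkovKernel (Kernel.comap _ _ _))

/-- The law of the trajectory `((s_t, a_t))_{t ≥ 0}` when `s_0 = s`, `a_t ∼ π(·|s_t)` and
`s_{t+1} ∼ P(·|s_t,a_t)`. -/
def trajLaw (M : FiniteMDP S A) (π : StochPolicy S A) (s : S) : Measure (ℕ → S × A) :=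
  Kernel.trajMeasure (X := fun _ => S × A)
    ((simplexMeasure (π s)).map (Prod.mk s)) (M.historyKernel π)

/-- The value function `V^π(s) = 𝔼[∑_{t ≥ 0} γ^t r(s_t, a_t) | π, s_0 = s]`. -/
def value (M : FiniteMDP S A) (π : StochPolicy S A) (s : S) : ℝ :=
  ∫ τ, ∑' t : ℕ, M.γ ^ t * M.r (τ t).1 (τ t).2 ∂(M.trajLaw π s)

/-- `V^π(ρ) = 𝔼_{s_0 ∼ ρ}[V^π(s_0)]`. -/
def valueFrom (M : FiniteMDP S A) (π : StochPolicy S A) (ρ : stdSimplex ℝ S) : ℝ :=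
  ∑ s, ρ s * M.value π s

/-- A policy is optimal if it maximizes `V^π(s)` simultaneously for all states `s`. -/
def IsOptimal (M : FiniteMDP S A) (π : StochPolicy S A) : Prop :=
  ∀ (π' : StochPolicy S A) (s : S), M.value π' s ≤ M.value π s

end FiniteMDP

end

/-! The ascent adds `η d(s) π(a|s) A(s,a)` to the logit of `(s,a)`, with `d` the discounted
occupancy and `A` the advantage. Each step is thus a multiplicative-weights update in every state,
so improvement can be proved state by state, without smoothness of the objective.

Progress: since `d` and `|A|` are at most `1/(1-γ)`, the exponents lie in `[-1,1]`, and
`le_sum_exp_reweight_mul` bounds the expected advantage of the new policy over the old one below by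
`(η μ(s)/6) ∑ (π A)²`. By policy improvement (`value_add_expAdvantage_le`) all values increase.
Being bounded, they converge to some `v`; the advantages converge to `L = q_v - v`, and positivity
of `μ` forces `π A → 0`.

Identification: `∑ π A = 0` prevents all `L(s,·)` from being negative. The hard part is `L ≤ 0`
(`limit_advantage_nonpos`). If `L(a₀) > 0`, then `π(a₀) → 0` although the logit of `a₀` eventually
never decreases. Let `G` be the actions with `L ≤ 0` and logits bounded below. Outside `G`, an
action either has `L > 0` or ends up dominated by `a₀`, so its probability vanishes. The total of `π
A` outside `G` is eventually nonnegative, so the sum of the logits in `G` stops growing. Each of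
these logits is then bounded above, and its probability vanishes relative to that of `a₀`. All
probabilities tend to zero, which is absurd. So `v` solves the Bellman optimality equation and is
the optimal value. -/

theorem stdSimplex_sum_eq_one {X : Type*} [Fintype X] (p : stdSimplex ℝ X) : ∑ x, p x = 1 := p.2.2

theorem stdSimplex_nonneg {X : Type*} [Fintype X] (p : stdSimplex ℝ X) (x : X) : 0 ≤ p x := p.2.1 x

theorem stdSimplex_expect_mem_Icc {X : Type*} [Fintype X] (p : stdSimplex ℝ X) {f : X → ℝ}
    {c d : ℝ} (hf : ∀ x, f x ∈ Icc c d) : ∑ x, p x * f x ∈ Icc c d := by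
  have h1 := stdSimplex_sum_eq_one p
  constructor
  · calc c = ∑ x, p x * c := by rw [← Finset.sum_mul, h1, one_mul]
      _ ≤ _ := Finset.sum_le_sum fun x _ =>
        mul_le_mul_of_nonneg_left (hf x).1 (stdSimplex_nonneg p x)
  · calc _ ≤ ∑ x, p x * d := Finset.sum_le_sum fun x _ =>
        mul_le_mul_of_nonneg_left (hf x).2 (stdSimplex_nonneg p x)
      _ = d := by rw [← Finset.sum_mul, h1, one_mul]

theorem integral_simplexMeasure {X : Type*} [Fintype X] [MeasurableSpace X]
    [DiscreteMeasurableSpace X] (p : stdSimplex ℝ X) (f : X → ℝ) :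
    ∫ x, f x ∂(simplexMeasure p) = ∑ x, p x * f x := by
  have hfin : ∀ x ∈ (Finset.univ : Finset X),
      Integrable f (ENNReal.ofReal (p x) • Measure.dirac x) := fun x _ =>
    (integrable_dirac (by simp)).smul_measure ENNReal.ofReal_ne_top
  rw [simplexMeasure, integral_finsetSum_measure hfin]
  refine Finset.sum_congr rfl fun x _ => ?_
  rw [integral_smul_measure, integral_dirac, ENNReal.toReal_ofReal (stdSimplex_nonneg p x),
    smul_eq_mul]

theorem sum_jointLaw_mul {S A : Type*} [Fintype S] [Fintype A] (p : stdSimplex ℝ S)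
    (π : StochPolicy S A) (f : S × A → ℝ) :
    ∑ x, jointLaw p π x * f x = ∑ s, p s * ∑ a, π s a * f (s, a) := by
  rw [Fintype.sum_prod_type]
  refine Finset.sum_congr rfl fun s _ => ?_
  rw [Finset.mul_sum]
  exact Finset.sum_congr rfl fun a _ => mul_assoc _ _ _

theorem integrable_comp_of_finite {Ω X : Type*} [MeasurableSpace Ω] [Finite X] [MeasurableSpace X]
    [DiscreteMeasurableSpace X] (ν : Measure Ω) [IsFiniteMeasure ν] (f : X → ℝ) {g : Ω → X}
    (hg : Measurable g) : Integrable (fun ω => f (g ω)) ν := by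
  obtain ⟨C, hC⟩ := (Set.finite_range fun x => ‖f x‖).bddAbove
  exact Integrable.of_bound ((Measurable.of_discrete (f := f)).comp hg).aestronglyMeasurable C
    (Eventually.of_forall fun ω => hC ⟨g ω, rfl⟩)

/-! ### Trajectory marginals and the Bellman equation. -/

namespace FiniteMDP

section Trajectory

variable {S A : Type*} [Fintype S] [Fintype A] [MeasurableSpace S] [DiscreteMeasurableSpace S]
  [MeasurableSpace A] [DiscreteMeasurableSpace A]

/-- The expectation of `f` after one step of the state-action chain. -/
def stepOp {S A : Type*} [Fintype S] [Fintype A] (M : FiniteMDP S A) (π : StochPolicy S A)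
    (f : S × A → ℝ) (x : S × A) : ℝ :=
  ∑ s', M.P x.1 x.2 s' * ∑ a', π s' a' * f (s', a')

instance isProbabilityMeasure_trajStart (π : StochPolicy S A) (s : S) :
    IsProbabilityMeasure ((simplexMeasure (π s)).map (Prod.mk s)) :=
  Measure.isProbabilityMeasure_map Measurable.of_discrete.aemeasurable

instance isProbabilityMeasure_trajLaw (M : FiniteMDP S A) (π : StochPolicy S A) (s : S) :
    IsProbabilityMeasure (M.trajLaw π s) :=
  inferInstanceAs (IsProbabilityMeasure (Kernel.trajMeasure _ _))

theorem integral_stepKernel (M : FiniteMDP S A) (π : StochPolicy S A) (f : S × A → ℝ) (x : S × A) :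
    ∫ y, f y ∂(M.stepKernel π x) = M.stepOp π f x :=
  (integral_simplexMeasure _ f).trans (sum_jointLaw_mul _ _ _)

theorem integral_trajLaw_zero (M : FiniteMDP S A) (π : StochPolicy S A) (s : S) (f : S × A → ℝ) :
    ∫ τ, f (τ 0) ∂(M.trajLaw π s) = ∑ a, π s a * f (s, a) := by
  set μ₀ := (simplexMeasure (π s)).map (Prod.mk s) with hμ₀
  have hmap : (M.trajLaw π s).map (Preorder.frestrictLe (π := fun _ => S × A) 0) =
      μ₀.map (MeasurableEquiv.piUnique (fun _ : Finset.Iic 0 => S × A)).symm := by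
    rw [trajLaw, Kernel.trajMeasure, Measure.map_comp _ _ (by fun_prop),
      Kernel.traj_map_frestrictLe, Kernel.partialTraj_self, Measure.id_comp]
  have h0 : ∫ τ, f (τ 0) ∂(M.trajLaw π s) =
      ∫ h, f (h ⟨0, Finset.mem_Iic.2 le_rfl⟩)
        ∂((M.trajLaw π s).map (Preorder.frestrictLe (π := fun _ => S × A) 0)) := by
    rw [integral_map (by fun_prop)]
    · rfl
    · exact ((Measurable.of_discrete (f := f)).comp (measurable_pi_apply _)).aestronglyMeasurable
  rw [h0, hmap, integral_map (by fun_prop)]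
  · rw [hμ₀, integral_map (Measurable.of_discrete.aemeasurable)]
    · exact integral_simplexMeasure (π s) fun a => f (s, a)
    · exact (Measurable.of_discrete).aestronglyMeasurable
  · exact ((Measurable.of_discrete (f := f)).comp (measurable_pi_apply _)).aestronglyMeasurable

/-- The history up to time `n` together with the next pair is distributed as the history law
composed with the kernel; integrating out the last pair leaves a function of time `n`. -/
theorem integral_trajLaw_succ (M : FiniteMDP S A) (π : StochPolicy S A) (s : S) (n : ℕ)
    (f : S × A → ℝ) :
    ∫ τ, f (τ (n + 1)) ∂(M.trajLaw π s) = ∫ τ, M.stepOp π f (τ n) ∂(M.trajLaw π s) := by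
  set ν := M.trajLaw π s with hν
  have key : ν.map (Preorder.frestrictLe (π := fun _ => S × A) n) ⊗ₘ M.historyKernel π n =
      ν.map (fun x => (Preorder.frestrictLe (π := fun _ => S × A) n x, x (n + 1))) :=
    Kernel.map_frestrictLe_trajMeasure_compProd_eq_map_trajMeasure (X := fun _ => S × A)
  have : IsProbabilityMeasure (ν.map (Preorder.frestrictLe (π := fun _ => S × A) n)) :=
    Measure.isProbabilityMeasure_map (by fun_prop)
  have h1 : ∫ τ, f (τ (n + 1)) ∂ν = ∫ z, f z.2
      ∂(ν.map (fun x => (Preorder.frestrictLe (π := fun _ => S × A) n x, x (n + 1)))) := by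
    rw [integral_map (by fun_prop)]
    exact ((Measurable.of_discrete (f := f)).comp measurable_snd).aestronglyMeasurable
  rw [h1, ← key, Measure.integral_compProd
    (integrable_comp_of_finite _ f measurable_snd), integral_map (by fun_prop)]
  · exact integral_congr_ae (Eventually.of_forall fun τ => M.integral_stepKernel π f (τ n))
  · have : (fun h : (_ : Finset.Iic n) → S × A => ∫ y, f y ∂(M.historyKernel π n h)) =
        fun h => M.stepOp π f (h ⟨n, Finset.mem_Iic.2 le_rfl⟩) :=
      funext fun h => M.integral_stepKernel π f _
    change AEStronglyMeasurable
      (fun h : (_ : Finset.Iic n) → S × A => ∫ y, f y ∂(M.historyKernel π n h)) _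
    rw [this]
    exact ((Measurable.of_discrete (f := M.stepOp π f)).comp
      (measurable_pi_apply _)).aestronglyMeasurable

theorem integral_trajLaw (M : FiniteMDP S A) (π : StochPolicy S A) (s : S) (n : ℕ)
    (f : S × A → ℝ) :
    ∫ τ, f (τ n) ∂(M.trajLaw π s) = ∑ a, π s a * (M.stepOp π)^[n] f (s, a) := by
  induction n generalizing f with
  | zero => exact M.integral_trajLaw_zero π s f
  | succ n ih => rw [integral_trajLaw_succ, ih]; rfl

/-- The expected reward at time `t`. -/
def rewardAt {S A : Type*} [Fintype S] [Fintype A] (M : FiniteMDP S A) (π : StochPolicy S A)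
    (t : ℕ) (s : S) : ℝ :=
  ∑ a, π s a * (M.stepOp π)^[t] (fun x => M.r x.1 x.2) (s, a)

theorem rewardAt_mem_Icc {S A : Type*} [Fintype S] [Fintype A] (M : FiniteMDP S A)
    (π : StochPolicy S A) (t : ℕ) (s : S) :
    M.rewardAt π t s ∈ Icc (0 : ℝ) 1 := by
  refine stdSimplex_expect_mem_Icc _ fun a => ?_
  suffices h : ∀ x, (M.stepOp π)^[t] (fun x => M.r x.1 x.2) x ∈ Icc (0 : ℝ) 1 from h _
  induction t with
  | zero => exact fun x => M.r_mem _ _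
  | succ t ih =>
    intro x
    rw [Function.iterate_succ_apply']
    exact stdSimplex_expect_mem_Icc _ fun s' => stdSimplex_expect_mem_Icc _ fun a' => ih _

theorem rewardAt_succ {S A : Type*} [Fintype S] [Fintype A] (M : FiniteMDP S A)
    (π : StochPolicy S A) (t : ℕ) (s : S) :
    M.rewardAt π (t + 1) s = ∑ a, π s a * ∑ s', M.P s a s' * M.rewardAt π t s' := by
  unfold rewardAt
  simp only [Function.iterate_succ_apply']
  rfl

theorem summable_rewardAt {S A : Type*} [Fintype S] [Fintype A] (M : FiniteMDP S A)
    (π : StochPolicy S A) (s : S) :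
    Summable fun t => M.γ ^ t * M.rewardAt π t s := by
  refine Summable.of_nonneg_of_le
    (fun t => mul_nonneg (pow_nonneg M.γ_mem.1 t) (M.rewardAt_mem_Icc π t s).1)
    (fun t => ?_) (summable_geometric_of_lt_one M.γ_mem.1 M.γ_mem.2)
  exact mul_le_of_le_one_right (pow_nonneg M.γ_mem.1 t) (M.rewardAt_mem_Icc π t s).2

theorem value_eq_tsum (M : FiniteMDP S A) (π : StochPolicy S A) (s : S) :
    M.value π s = ∑' t, M.γ ^ t * M.rewardAt π t s := by
  have hint : ∀ t, Integrable (fun τ : ℕ → S × A => M.γ ^ t * M.r (τ t).1 (τ t).2)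
      (M.trajLaw π s) := fun t =>
    integrable_comp_of_finite _ (fun x : S × A => M.γ ^ t * M.r x.1 x.2) (measurable_pi_apply t)
  have hval : ∀ t, ∫ τ, M.γ ^ t * M.r (τ t).1 (τ t).2 ∂(M.trajLaw π s) =
      M.γ ^ t * M.rewardAt π t s := fun t => by
    rw [integral_const_mul]
    exact congrArg _ (M.integral_trajLaw π s t fun x => M.r x.1 x.2)
  rw [value, ← integral_tsum_of_summable_integral_norm hint]
  · exact tsum_congr hval
  · refine (M.summable_rewardAt π s).congr fun t => ?_
    rw [← hval t]
    refine integral_congr_ae (Eventually.of_forall fun τ => ?_)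
    exact (Real.norm_of_nonneg
      (mul_nonneg (pow_nonneg M.γ_mem.1 t) (M.r_mem _ _).1)).symm

/-- The state-action value obtained by continuing with the value function `v`. -/
def qValue {S A : Type*} [Fintype S] [Fintype A] (M : FiniteMDP S A) (v : S → ℝ) (s : S) (a : A) :
    ℝ :=
  M.r s a + M.γ * ∑ s', M.P s a s' * v s'

/-- The Bellman equation. -/
theorem value_eq (M : FiniteMDP S A) (π : StochPolicy S A) (s : S) :
    M.value π s = ∑ a, π s a * M.qValue (M.value π) s a := by
  have h2 : HasSum (fun t => M.γ ^ (t + 1) * M.rewardAt π (t + 1) s)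
      (∑ a, π s a * (M.γ * ∑ s', M.P s a s' * M.value π s')) := by
    have h : ∀ t, M.γ ^ (t + 1) * M.rewardAt π (t + 1) s =
        ∑ a, π s a * (M.γ * ∑ s', M.P s a s' * (M.γ ^ t * M.rewardAt π t s')) := fun t => by
      rw [rewardAt_succ, Finset.mul_sum]
      refine Finset.sum_congr rfl fun a _ => ?_
      simp only [Finset.mul_sum]
      exact Finset.sum_congr rfl fun s' _ => by ring
    simp only [h, value_eq_tsum]
    exact hasSum_sum fun a _ => (HasSum.mul_left _ (hasSum_sum fun s' _ =>
      (M.summable_rewardAt π s').hasSum.mul_left _)).mul_left _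
  have h0 := (M.summable_rewardAt π s).tsum_eq_zero_add
  rw [h2.tsum_eq, ← value_eq_tsum] at h0
  rw [h0, rewardAt, pow_zero, one_mul, ← Finset.sum_add_distrib]
  exact Finset.sum_congr rfl fun a _ => by
    simp only [Function.iterate_zero, id, qValue]; ring

theorem value_mem_Icc (M : FiniteMDP S A) (π : StochPolicy S A) (s : S) :
    M.value π s ∈ Icc 0 (1 - M.γ)⁻¹ := by
  rw [value_eq_tsum]
  refine ⟨tsum_nonneg fun t =>
    mul_nonneg (pow_nonneg M.γ_mem.1 t) (M.rewardAt_mem_Icc π t s).1, ?_⟩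
  rw [← tsum_geometric_of_lt_one M.γ_mem.1 M.γ_mem.2]
  exact (M.summable_rewardAt π s).tsum_le_tsum
    (fun t => mul_le_of_le_one_right (pow_nonneg M.γ_mem.1 t) (M.rewardAt_mem_Icc π t s).2)
    (summable_geometric_of_lt_one M.γ_mem.1 M.γ_mem.2)

end Trajectory

end FiniteMDP

/-! ### Differentiating the softmax map. -/

/-- The factor `u y - u x` vanishes at `x`, so continuity of `v` is enough. This yields the policy
gradient without first differentiating the value function. -/
theorem hasFDerivAt_sub_mul_of_continuousAt {E : Type*} [NormedAddCommGroup E] [NormedSpace ℝ E]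
    {u v : E → ℝ} {u' : E →L[ℝ] ℝ} {x : E} (hu : HasFDerivAt u u' x) (hv : ContinuousAt v x) :
    HasFDerivAt (fun y => (u y - u x) * v y) (v x • u') x := by
  have h1 : (fun y => (u y - u x) * (v y - v x)) =o[𝓝 x] fun y => y - x := by
    have h := hu.isBigO_sub.norm_right.mul_isLittleO
      ((Asymptotics.isLittleO_one_iff ℝ).2 (tendsto_sub_nhds_zero_iff.2 hv.tendsto))
    simp only [mul_one] at h
    exact h.of_norm_right
  have h2 := ((hasFDerivAt_iff_isLittleO.1 hu).const_mul_left (v x)).add h1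
  refine HasFDerivAt.of_isLittleO (h2.congr_left fun y => ?_)
  simp only [smul_eq_mul, FunLike.coe_smul, Pi.smul_apply]
  ring

theorem hasFDerivAt_softmaxPolicy {S A : Type*} [Fintype S] [Fintype A] [Nonempty A]
    (θ : EuclideanSpace ℝ (S × A)) (s : S) (a : A) :
    HasFDerivAt (fun ϑ : EuclideanSpace ℝ (S × A) => softmaxPolicy ϑ s a)
      (softmaxPolicy θ s a • ((EuclideanSpace.proj (s, a) : EuclideanSpace ℝ (S × A) →L[ℝ] ℝ) -
        ∑ b, softmaxPolicy θ s b •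
          (EuclideanSpace.proj (s, b) : EuclideanSpace ℝ (S × A) →L[ℝ] ℝ))) θ := by
  have hZ : (∑ b, Real.exp (θ (s, b))) ≠ 0 :=
    (Finset.sum_pos (fun _ _ => Real.exp_pos _) Finset.univ_nonempty).ne'
  have hp : ∀ b, HasFDerivAt (fun ϑ : EuclideanSpace ℝ (S × A) => Real.exp (ϑ (s, b)))
      (Real.exp (θ (s, b)) •
        (EuclideanSpace.proj (s, b) : EuclideanSpace ℝ (S × A) →L[ℝ] ℝ)) θ := fun b =>
    (EuclideanSpace.proj (s, b) : EuclideanSpace ℝ (S × A) →L[ℝ] ℝ).hasFDerivAt.exp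
  have hs := HasFDerivAt.fun_sum (u := Finset.univ) fun b (_ : b ∈ Finset.univ) => hp b
  have h := (hp a).mul ((hasDerivAt_inv hZ).comp_hasFDerivAt θ hs)
  refine HasFDerivAt.congr_fderiv (f' := _) (h : HasFDerivAt
    (fun ϑ : EuclideanSpace ℝ (S × A) => softmaxPolicy ϑ s a) _ θ) ?_
  ext v
  simp only [softmaxPolicy, FunLike.coe_smul, Pi.smul_apply, FunLike.coe_sub, Pi.sub_apply,
    FunLike.coe_sum, Finset.sum_apply, smul_eq_mul, FunLike.coe_add, Pi.add_apply,
    Function.comp_apply]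
  change _ = (Real.exp (θ (s, a)) / _) * (_ - ∑ b, (Real.exp (θ (s, b)) / _) * _)
  simp only [div_mul_eq_mul_div, ← Finset.sum_div]
  field_simp
  ring

theorem softmaxPolicy_pos {S A : Type*} [Fintype A] [Nonempty A]
    (θ : EuclideanSpace ℝ (S × A)) (s : S) (a : A) : 0 < softmaxPolicy θ s a :=
  div_pos (Real.exp_pos _) (Finset.sum_pos (fun _ _ => Real.exp_pos _) Finset.univ_nonempty)

/-! ### The next-state operator and comparison principles. -/

namespace FiniteMDP

/-- The expectation of `g` at the next state under `π`. -/
def nextOp {S A : Type*} [Fintype S] [Fintype A] (M : FiniteMDP S A) (π : StochPolicy S A)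
    (g : S → ℝ) (s : S) : ℝ :=
  ∑ a, π s a * ∑ s', M.P s a s' * g s'

section NextOp

variable {S A : Type*} [Fintype S] [Fintype A] (M : FiniteMDP S A) (π : StochPolicy S A)

theorem nextOp_mem_Icc {g : S → ℝ} {c d : ℝ} (hg : ∀ s, g s ∈ Icc c d) (s : S) :
    M.nextOp π g s ∈ Icc c d :=
  stdSimplex_expect_mem_Icc _ fun _ => stdSimplex_expect_mem_Icc _ hg

theorem nextOp_nonneg {g : S → ℝ} (hg : ∀ s, 0 ≤ g s) (s : S) : 0 ≤ M.nextOp π g s :=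
  Finset.sum_nonneg fun _ _ => mul_nonneg (stdSimplex_nonneg _ _) <|
    Finset.sum_nonneg fun _ _ => mul_nonneg (stdSimplex_nonneg _ _) (hg _)

theorem nextOp_sub (f g : S → ℝ) (s : S) :
    M.nextOp π (fun s => f s - g s) s = M.nextOp π f s - M.nextOp π g s := by
  simp only [nextOp, mul_sub, Finset.sum_sub_distrib]

theorem nextOp_sum_mul {ι : Type*} [Fintype ι] (c : ι → ℝ) (W : ι → S → ℝ) (s : S) :
    M.nextOp π (fun s => ∑ i, c i * W i s) s = ∑ i, c i * M.nextOp π (W i) s := by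
  simp only [nextOp, Finset.mul_sum]
  rw [Finset.sum_comm' (t' := Finset.univ) (s' := fun _ => Finset.univ) (by simp)]
  rw [Finset.sum_comm]
  conv_rhs => rw [Finset.sum_comm]
  refine Finset.sum_congr rfl fun a _ => ?_
  rw [Finset.sum_comm]
  exact Finset.sum_congr rfl fun i _ => Finset.sum_congr rfl fun s' _ => by ring

theorem sum_mul_qValue (v : S → ℝ) (s : S) :
    ∑ a, π s a * M.qValue v s a = ∑ a, π s a * M.r s a + M.γ * M.nextOp π v s := by
  simp only [qValue, mul_add, Finset.sum_add_distrib, nextOp, Finset.mul_sum]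
  congr 1
  exact Finset.sum_congr rfl fun a _ => Finset.sum_congr rfl fun s' _ => by ring

/-- Maximum principle: at a maximizer, averaging gives `max g ≤ γ max g`, and `γ < 1`. -/
theorem nonpos_of_le_nextOp {g : S → ℝ} (hg : ∀ s, g s ≤ M.γ * M.nextOp π g s) (s : S) :
    g s ≤ 0 := by
  have : Nonempty S := ⟨s⟩
  obtain ⟨s₀, hs₀⟩ := Finite.exists_max g
  obtain ⟨s₁, hs₁⟩ := Finite.exists_min g
  have h := (M.nextOp_mem_Icc π (fun s => ⟨hs₁ s, hs₀ s⟩) s₀).2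
  have h2 := mul_le_mul_of_nonneg_left h M.γ_mem.1
  have h3 := hg s₀
  have h4 := M.γ_mem.2
  have h5 := hs₀ s
  by_contra! hc
  nlinarith

theorem le_of_sub_le_nextOp {f g : S → ℝ}
    (h : ∀ s, f s - g s ≤ M.γ * M.nextOp π (fun s => f s - g s) s) (s : S) : f s ≤ g s :=
  sub_nonpos.1 (M.nonpos_of_le_nextOp π h s)

theorem eq_of_sub_eq_nextOp {f g : S → ℝ}
    (h : ∀ s, f s - g s = M.γ * M.nextOp π (fun s => f s - g s) s) (s : S) : f s = g s := by
  refine le_antisymm (M.le_of_sub_le_nextOp π (fun s => (h s).le) s)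
    (M.le_of_sub_le_nextOp π (fun s => ?_) s)
  have := h s
  rw [nextOp_sub] at this ⊢
  linarith

theorem qValue_mem_Icc {v : S → ℝ} (hv : ∀ s, v s ∈ Icc 0 (1 - M.γ)⁻¹) (s : S) (a : A) :
    M.qValue v s a ∈ Icc 0 (1 - M.γ)⁻¹ := by
  have h1 := stdSimplex_expect_mem_Icc (M.P s a) hv
  have h2 := M.r_mem s a
  have h3 := M.γ_mem
  have h4 : (1 - M.γ)⁻¹ = 1 + M.γ * (1 - M.γ)⁻¹ := by
    have : 1 - M.γ ≠ 0 := by linarith [h3.2]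
    field_simp
    ring
  refine ⟨add_nonneg h2.1 (mul_nonneg h3.1 h1.1), ?_⟩
  rw [h4]
  exact add_le_add h2.2 (mul_le_mul_of_nonneg_left h1.2 h3.1)

end NextOp

/-! ### Policy improvement, performance difference and the policy gradient. -/

section Value

variable {S A : Type*} [Fintype S] [Fintype A] [MeasurableSpace S] [DiscreteMeasurableSpace S]
  [MeasurableSpace A] [DiscreteMeasurableSpace A] (M : FiniteMDP S A) (π π' : StochPolicy S A)

theorem value_eq_add_nextOp (s : S) :
    M.value π s = ∑ a, π s a * M.r s a + M.γ * M.nextOp π (M.value π) s := by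
  rw [← sum_mul_qValue, ← value_eq]

theorem value_le_of_qValue_le {v : S → ℝ} (hv : ∀ s, ∑ a, π s a * M.qValue v s a ≤ v s) (s : S) :
    M.value π s ≤ v s := by
  refine M.le_of_sub_le_nextOp π (fun s => ?_) s
  have h := hv s
  rw [sum_mul_qValue] at h
  rw [nextOp_sub, M.value_eq_add_nextOp π s]
  linarith

theorem le_value_of_le_qValue {v : S → ℝ} (hv : ∀ s, v s ≤ ∑ a, π s a * M.qValue v s a) (s : S) :
    v s ≤ M.value π s := by
  refine M.le_of_sub_le_nextOp π (fun s => ?_) s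
  have h := hv s
  rw [sum_mul_qValue] at h
  rw [nextOp_sub, M.value_eq_add_nextOp π s]
  linarith

/-- The expected advantage of `π'` over `π` at `s`. -/
noncomputable def expAdvantage (s : S) : ℝ := ∑ a, π' s a * (M.qValue (M.value π) s a - M.value π s)

theorem expAdvantage_eq (s : S) :
    M.expAdvantage π π' s = ∑ a, π' s a * M.qValue (M.value π) s a - M.value π s := by
  simp only [expAdvantage, mul_sub, Finset.sum_sub_distrib, ← Finset.sum_mul,
    stdSimplex_sum_eq_one, one_mul]

theorem expAdvantage_self (s : S) : M.expAdvantage π π s = 0 := by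
  rw [expAdvantage_eq, ← value_eq, sub_self]

/-- Nonnegative expected advantages make `π'` at least as good everywhere. The gain at `s` is then
the advantage there plus a discounted future gain, which is dropped. -/
theorem value_add_expAdvantage_le (h : ∀ s, 0 ≤ M.expAdvantage π π' s) (s : S) :
    M.value π s + M.expAdvantage π π' s ≤ M.value π' s := by
  have h1 : ∀ s, M.value π s ≤ M.value π' s := M.le_value_of_le_qValue π' fun s => by
    have := h s
    rw [expAdvantage_eq] at this
    linarith
  have h2 := M.nextOp_nonneg π' (fun s => sub_nonneg.2 (h1 s)) s
  rw [nextOp_sub] at h2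
  have h3 := mul_nonneg M.γ_mem.1 h2
  rw [expAdvantage_eq, sum_mul_qValue, M.value_eq_add_nextOp π' s]
  linarith

open Classical in
/-- The same decision process, where the reward is one in the state `s` and zero elsewhere. -/
noncomputable def visitMDP {S A : Type*} [Fintype S] [Fintype A] (M : FiniteMDP S A) (s : S) :
    FiniteMDP S A where
  P := M.P
  r := fun s' _ => if s' = s then 1 else 0
  γ := M.γ
  r_mem := fun s' _ => by split_ifs <;> simp
  γ_mem := M.γ_mem

/-- The expected discounted number of visits to `s` when starting from `s₀`. -/
noncomputable def visits (s s₀ : S) : ℝ := (M.visitMDP s).value π s₀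

open Classical in
theorem visits_eq (s s₀ : S) :
    M.visits π s s₀ = (if s₀ = s then 1 else 0) + M.γ * M.nextOp π (M.visits π s) s₀ := by
  have h := (M.visitMDP s).value_eq_add_nextOp π s₀
  simp only [visitMDP, ← Finset.sum_mul, stdSimplex_sum_eq_one, one_mul] at h
  exact h

theorem visits_mem_Icc (s s₀ : S) : M.visits π s s₀ ∈ Icc 0 (1 - M.γ)⁻¹ :=
  (M.visitMDP s).value_mem_Icc π s₀

theorem one_le_visits_self (s : S) : 1 ≤ M.visits π s s := by
  classical
  rw [visits_eq, if_pos rfl]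
  have := mul_nonneg M.γ_mem.1 (M.nextOp_nonneg π (fun s₀ => (M.visits_mem_Icc π s s₀).1) s)
  linarith

/-- The visit counts are the Green function of `g = h + γ P_π g`: superposing them with weights `h`
solves the equation, and the solution is unique. -/
theorem eq_sum_mul_visits {g h : S → ℝ} (hg : ∀ s, g s = h s + M.γ * M.nextOp π g s) (s₀ : S) :
    g s₀ = ∑ s, h s * M.visits π s s₀ := by
  classical
  refine M.eq_of_sub_eq_nextOp π (g := fun s₀ => ∑ s, h s * M.visits π s s₀) (fun s₀ => ?_) s₀
  rw [nextOp_sub, nextOp_sum_mul, hg s₀]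
  simp only [M.visits_eq π _ s₀, mul_add, Finset.sum_add_distrib]
  simp only [mul_ite, mul_one, mul_zero, Finset.sum_ite_eq, Finset.mem_univ, if_true,
    mul_left_comm (h _) M.γ, ← Finset.mul_sum]
  ring

/-- Performance difference, in the form with visits under `π` but action values of `π'`. For fixed
`π` only the policy difference and a bounded, continuous factor then vary with `π'`. -/
theorem value_sub_value (s₀ : S) :
    M.value π' s₀ - M.value π s₀ =
      ∑ s, (∑ a, (π' s a - π s a) * M.qValue (M.value π') s a) * M.visits π s s₀ := by
  refine M.eq_sum_mul_visits π (g := fun s => M.value π' s - M.value π s) (fun s => ?_) s₀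
  simp only [sub_mul, Finset.sum_sub_distrib]
  rw [← value_eq, sum_mul_qValue, nextOp_sub, M.value_eq_add_nextOp π s]
  ring

/-- The discounted state occupancy under `π` for the start distribution `μ`. -/
noncomputable def occupancy (μ : stdSimplex ℝ S) (s : S) : ℝ := ∑ s₀, μ s₀ * M.visits π s s₀

theorem occupancy_mem_Icc (μ : stdSimplex ℝ S) (s : S) :
    M.occupancy π μ s ∈ Icc (μ s) (1 - M.γ)⁻¹ := by
  refine ⟨?_, (stdSimplex_expect_mem_Icc μ (M.visits_mem_Icc π s)).2⟩
  calc μ s ≤ μ s * M.visits π s s :=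
        le_mul_of_one_le_right (stdSimplex_nonneg μ s) (M.one_le_visits_self π s)
    _ ≤ _ := Finset.single_le_sum (f := fun s₀ => μ s₀ * M.visits π s s₀)
        (fun s₀ _ => mul_nonneg (stdSimplex_nonneg μ s₀) (M.visits_mem_Icc π s s₀).1)
        (Finset.mem_univ s)

theorem valueFrom_sub_valueFrom (μ : stdSimplex ℝ S) :
    M.valueFrom π' μ - M.valueFrom π μ =
      ∑ s, M.occupancy π μ s * ∑ a, (π' s a - π s a) * M.qValue (M.value π') s a := by
  rw [valueFrom, valueFrom, ← Finset.sum_sub_distrib]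
  simp only [← mul_sub, value_sub_value, Finset.mul_sum, occupancy, Finset.sum_mul]
  rw [Finset.sum_comm]
  refine Finset.sum_congr rfl fun s _ => ?_
  rw [Finset.sum_comm]
  exact Finset.sum_congr rfl fun a _ => Finset.sum_congr rfl fun s₀ _ => by ring

variable [Nonempty A]

theorem continuous_value_softmaxPolicy (s₀ : S) :
    Continuous fun ϑ : EuclideanSpace ℝ (S × A) => M.value (softmaxPolicy ϑ) s₀ := by
  refine continuous_iff_continuousAt.2 fun θ => tendsto_sub_nhds_zero_iff.1 ?_
  simp only [value_sub_value]
  rw [show (0 : ℝ) = ∑ s : S, (∑ _a : A, 0) * M.visits (softmaxPolicy θ) s s₀ by simp]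
  refine tendsto_finsetSum _ fun s _ => (tendsto_finsetSum _ fun a _ => ?_).mul_const _
  refine Tendsto.zero_mul_isBoundedUnder_le
    (tendsto_sub_nhds_zero_iff.2 (hasFDerivAt_softmaxPolicy θ s a).continuousAt)
    (isBoundedUnder_of ⟨(1 - M.γ)⁻¹, fun ϑ => ?_⟩)
  have h := M.qValue_mem_Icc (M.value_mem_Icc (softmaxPolicy ϑ)) s a
  exact (Real.norm_of_nonneg h.1).trans_le h.2

/-- The policy gradient theorem for the softmax parametrization. -/
theorem hasGradientAt_valueFrom_softmaxPolicy (μ : stdSimplex ℝ S)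
    (θ : EuclideanSpace ℝ (S × A)) :
    HasGradientAt (fun ϑ => M.valueFrom (softmaxPolicy ϑ) μ)
      (WithLp.toLp 2 fun x : S × A => M.occupancy (softmaxPolicy θ) μ x.1 *
        (softmaxPolicy θ x.1 x.2 * (M.qValue (M.value (softmaxPolicy θ)) x.1 x.2 -
          M.value (softmaxPolicy θ) x.1))) θ := by
  have hq : ∀ s a, ContinuousAt (fun ϑ : EuclideanSpace ℝ (S × A) =>
      M.qValue (M.value (softmaxPolicy ϑ)) s a) θ := fun s a => by
    refine Continuous.continuousAt ?_
    unfold qValue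
    have := M.continuous_value_softmaxPolicy
    fun_prop
  have h1 := HasFDerivAt.fun_sum (u := Finset.univ) fun s (_ : s ∈ Finset.univ) =>
    (HasFDerivAt.fun_sum (u := Finset.univ) fun a (_ : a ∈ Finset.univ) =>
      hasFDerivAt_sub_mul_of_continuousAt (hasFDerivAt_softmaxPolicy θ s a) (hq s a)).const_mul
        (M.occupancy (softmaxPolicy θ) μ s)
  have h2 := h1.add_const (M.valueFrom (softmaxPolicy θ) μ)
  simp only [← valueFrom_sub_valueFrom, sub_add_cancel] at h2
  rw [hasGradientAt_iff_hasFDerivAt]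
  refine h2.congr_fderiv ?_
  ext v
  simp only [FunLike.coe_smul, Pi.smul_apply, FunLike.coe_sub, Pi.sub_apply,
    FunLike.coe_sum, Finset.sum_apply, smul_eq_mul, InnerProductSpace.toDual_apply_apply,
    PiLp.inner_apply, Fintype.sum_prod_type, RCLike.inner_apply, conj_trivial]
  refine Finset.sum_congr rfl fun s _ => ?_
  set c := ∑ b, softmaxPolicy θ s b * v (s, b) with hc
  -- The normalizing term of the softmax derivative becomes, by the Bellman equation, the baseline
  -- `V` that turns action values into advantages.
  have h3 : ∑ a, M.qValue (M.value (softmaxPolicy θ)) s a * (softmaxPolicy θ s a * (v (s, a) - c)) =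
      ∑ a, softmaxPolicy θ s a * M.qValue (M.value (softmaxPolicy θ)) s a * v (s, a) -
        M.value (softmaxPolicy θ) s * c := by
    rw [M.value_eq (softmaxPolicy θ) s, Finset.sum_mul, ← Finset.sum_sub_distrib]
    exact Finset.sum_congr rfl fun a _ => by ring
  refine (congrArg _ h3).trans ?_
  rw [hc, Finset.mul_sum, ← Finset.sum_sub_distrib, Finset.mul_sum]
  exact Finset.sum_congr rfl fun a _ => by ring

end Value

end FiniteMDP

/-! ### Progress of one multiplicative-weights step. -/

theorem exp_le_one_add_half {x : ℝ} (h₀ : x ≤ 0) (h₁ : -1 ≤ x) : Real.exp x ≤ 1 + x / 2 := by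
  have h2 := Real.add_one_le_exp (-x)
  have h3 : Real.exp x * Real.exp (-x) = 1 := by rw [← Real.exp_add, add_neg_cancel, Real.exp_zero]
  have h4 : Real.exp x * (1 - x) ≤ 1 := by
    rw [← h3]
    exact mul_le_mul_of_nonneg_left (by linarith) (Real.exp_pos x).le
  have h5 : 1 ≤ (1 + x / 2) * (1 - x) := by nlinarith
  exact le_of_mul_le_mul_right (h4.trans h5) (by linarith)

theorem mul_half_mul_le_mul_exp_sub_one {c k : ℝ} (hk : 0 ≤ k) (h : |k * c| ≤ 1) :
    c * (k * c / 2) ≤ c * (Real.exp (k * c) - 1) := by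
  rcases le_total 0 c with hc | hc
  · refine mul_le_mul_of_nonneg_left ?_ hc
    have := Real.add_one_le_exp (k * c)
    have := mul_nonneg hk hc
    linarith
  · refine mul_le_mul_of_nonpos_left ?_ hc
    have := exp_le_one_add_half (mul_nonpos_of_nonneg_of_nonpos hk hc) (abs_le.1 h).1
    linarith

/-- A multiplicative-weights step along the policy gradient increases the expected advantage. -/
theorem le_sum_exp_reweight_mul {A : Type*} [Fintype A] {p c : A → ℝ} {w : ℝ}
    (hp : ∀ a, 0 ≤ p a) (hp1 : ∑ a, p a = 1) (hpc : ∑ a, p a * c a = 0) (hw : 0 ≤ w)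
    (h : ∀ a, |w * (p a * c a)| ≤ 1) :
    w / 6 * ∑ a, (p a * c a) ^ 2 ≤
      ∑ a, p a * Real.exp (w * (p a * c a)) / (∑ b, p b * Real.exp (w * (p b * c b))) * c a := by
  set Z := ∑ b, p b * Real.exp (w * (p b * c b)) with hZ
  have hZ0 : 0 < Z := by
    have : Real.exp (-1) ≤ Z := by
      rw [hZ]
      calc Real.exp (-1) = ∑ a, p a * Real.exp (-1) := by rw [← Finset.sum_mul, hp1, one_mul]
        _ ≤ _ := Finset.sum_le_sum fun a _ =>
          mul_le_mul_of_nonneg_left (Real.exp_le_exp.2 (abs_le.1 (h a)).1) (hp a)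
    exact (Real.exp_pos _).trans_le this
  have hZ3 : Z ≤ 3 := by
    calc Z ≤ ∑ a, p a * 3 := Finset.sum_le_sum fun a _ => mul_le_mul_of_nonneg_left
            ((Real.exp_le_exp.2 (abs_le.1 (h a)).2).trans Real.exp_one_lt_three.le) (hp a)
      _ = 3 := by rw [← Finset.sum_mul, hp1, one_mul]
  have hnum : w / 2 * ∑ a, (p a * c a) ^ 2 ≤ ∑ a, p a * Real.exp (w * (p a * c a)) * c a := by
    have h1 : ∑ a, p a * Real.exp (w * (p a * c a)) * c a =
        ∑ a, p a * (c a * (Real.exp (w * p a * c a) - 1)) := by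
      -- Subtracting `∑ p c = 0` replaces `exp` by `exp - 1`, which has the sign of `c`. The
      -- normalizer bound `Z ≤ 3` later turns the factor `1/2` into `1/6`.
      rw [← sub_zero (∑ a, p a * Real.exp (w * (p a * c a)) * c a), ← hpc,
        ← Finset.sum_sub_distrib]
      exact Finset.sum_congr rfl fun a _ => by rw [mul_assoc w]; ring
    rw [h1, Finset.mul_sum]
    refine Finset.sum_le_sum fun a _ => ?_
    have := mul_le_mul_of_nonneg_left (mul_half_mul_le_mul_exp_sub_one (c := c a)
      (mul_nonneg hw (hp a)) (by rw [mul_assoc]; exact h a)) (hp a)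
    exact (le_of_eq (by ring)).trans this
  have hsum : ∑ a, p a * Real.exp (w * (p a * c a)) / Z * c a =
      (∑ a, p a * Real.exp (w * (p a * c a)) * c a) / Z := by
    rw [Finset.sum_div]
    exact Finset.sum_congr rfl fun a _ => by ring
  rw [hsum, le_div_iff₀ hZ0]
  refine le_trans ?_ hnum
  have h0 : 0 ≤ ∑ a, (p a * c a) ^ 2 := Finset.sum_nonneg fun a _ => sq_nonneg _
  have h1 : 0 ≤ w / 6 * ∑ a, (p a * c a) ^ 2 := by positivity
  nlinarith [mul_le_mul_of_nonneg_left hZ3 h1]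

/-! ### Softmax dynamics with convergent advantages. -/

theorem bddBelow_range_of_eventually_le {u : ℕ → ℝ} {c : ℝ} (h : ∀ᶠ t in atTop, c ≤ u t) :
    BddBelow (range u) :=
  (isBoundedUnder_of_eventually_ge h).bddBelow_range

/-- Softmax weights that follow the policy gradient cannot keep an advantage positive in the
limit. -/
theorem limit_advantage_nonpos {A : Type*} [Fintype A] {x adv : ℕ → A → ℝ} {w : ℕ → ℝ} {L : A → ℝ}
    {p : ℕ → A → ℝ} (hp : ∀ t a, p t a = Real.exp (x t a) / ∑ b, Real.exp (x t b))
    (hw : ∀ t, 0 ≤ w t) (hx : ∀ t a, x (t + 1) a = x t a + w t * (p t a * adv t a))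
    (hsum : ∀ t, ∑ a, p t a * adv t a = 0)
    (hlim : ∀ a, Tendsto (fun t => adv t a) atTop (𝓝 (L a)))
    (hzero : ∀ a, Tendsto (fun t => p t a * adv t a) atTop (𝓝 0)) (a₀ : A) : L a₀ ≤ 0 := by
  classical
  by_contra! hpos
  set Δ := L a₀ with hΔ
  have : Nonempty A := ⟨a₀⟩
  have hZ : ∀ t, 0 < ∑ b, Real.exp (x t b) := fun t =>
    Finset.sum_pos (fun _ _ => Real.exp_pos _) Finset.univ_nonempty
  have hp0 : ∀ t a, 0 < p t a := fun t a => by rw [hp]; exact div_pos (Real.exp_pos _) (hZ t)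
  have hratio : ∀ t a b k, x t a ≤ x t b + k → p t a ≤ Real.exp k * p t b := fun t a b k h => by
    rw [hp, hp, ← mul_div_assoc, ← Real.exp_add]
    exact div_le_div_of_nonneg_right (Real.exp_le_exp.2 (by linarith)) (hZ t).le
  have hmono : ∀ t a b, x t a ≤ x t b → p t a ≤ p t b := fun t a b h => by
    simpa using hratio t a b 0 (by simpa using h)
  have hN : (0 : ℝ) < Fintype.card A := by exact_mod_cast Fintype.card_pos
  -- Chosen so that `|A|` losses of size `ε p(a₀)` are paid for by the gain `(Δ/2) p(a₀)`.
  set ε : ℝ := Δ / (2 * Fintype.card A) with hε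
  have hε0 : 0 < ε := by positivity
  have hp_lim : ∀ a, L a ≠ 0 → Tendsto (fun t => p t a) atTop (𝓝 0) := fun a ha => by
    have h := (hzero a).div (hlim a) ha
    rw [zero_div] at h
    refine h.congr' ?_
    filter_upwards [(hlim a).eventually_ne ha] with t ht
    simp [ht]
  obtain ⟨T, hT⟩ : ∃ T, ∀ t ≥ T, Δ / 2 ≤ adv t a₀ ∧ ∀ a, (0 < L a → 0 ≤ adv t a) ∧
      (L a ≤ 0 → adv t a ≤ adv t a₀) ∧ (L a < 0 → adv t a ≤ 0) ∧ (L a = 0 → -ε ≤ adv t a) ∧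
      L a - 1 ≤ adv t a := by
    refine eventually_atTop.1 (((hlim a₀).eventually_const_le (half_lt_self hpos)).and
      (eventually_all.2 fun a => ?_))
    have himp : ∀ {P : Prop} {Q : ℕ → Prop}, (P → ∀ᶠ t in atTop, Q t) →
        ∀ᶠ t in atTop, P → Q t := fun {P} {Q} h => by
      by_cases hP : P
      · exact (h hP).mono fun t ht _ => ht
      · exact Eventually.of_forall fun t h' => absurd h' hP
    refine (himp fun h => (hlim a).eventually_const_le h).and
      ((himp fun h => ?_).and ((himp fun h => (hlim a).eventually_le_const h).and
      ((himp fun h => (hlim a).eventually_const_le (by linarith)).and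
      ((hlim a).eventually_const_le (by linarith)))))
    filter_upwards [(hlim a).eventually_lt (hlim a₀) (h.trans_lt hpos)] with t ht using ht.le
  have hx₀ : ∀ t ≥ T, x T a₀ ≤ x t a₀ := fun t ht => by
    induction t, ht using Nat.le_induction with
    | base => exact le_rfl
    | succ t ht ih =>
      rw [hx]
      have := mul_nonneg (hw t) (mul_nonneg (hp0 t a₀).le
        ((half_pos hpos).le.trans (hT t ht).1))
      linarith
  -- An unbounded logit falls below that of `a₀` at some time past `T`. From then on both the
  -- probability and the advantage of `a` are at most those of `a₀`, so the order persists.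
  have hlow : ∀ a, L a ≤ 0 → ¬ BddBelow (range fun t => x t a) →
      ∀ᶠ t in atTop, x t a ≤ x t a₀ := fun a ha hb => by
    obtain ⟨T', hT', hle⟩ : ∃ t ≥ T, x t a ≤ x t a₀ := by
      by_contra! h
      exact hb (bddBelow_range_of_eventually_le (c := x T a₀)
        ((eventually_ge_atTop T).mono fun t ht => (hx₀ t ht).trans (h t ht).le))
    refine eventually_atTop.2 ⟨T', fun t ht => ?_⟩
    induction t, ht using Nat.le_induction with
    | base => exact hle
    | succ t ht ih =>
      have hadv := hT t (hT'.trans ht)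
      rw [hx, hx]
      refine add_le_add ih (mul_le_mul_of_nonneg_left ?_ (hw t))
      calc p t a * adv t a ≤ p t a * adv t a₀ :=
            mul_le_mul_of_nonneg_left ((hadv.2 a).2.1 ha) (hp0 t a).le
        _ ≤ _ := mul_le_mul_of_nonneg_right (hmono t a a₀ ih)
            ((half_pos hpos).le.trans hadv.1)
  have hneg : ∀ a, L a ≤ 0 → ¬ BddBelow (range fun t => x t a) →
      ∀ᶠ t in atTop, -(ε * p t a₀) ≤ p t a * adv t a := fun a ha hb => by
    rcases ha.eq_or_lt with h0 | hlt
    · filter_upwards [hlow a ha hb, eventually_ge_atTop T] with t ht htT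
      have h1 := ((hT t htT).2 a).2.2.2.1 h0
      have h2 := hmono t a a₀ ht
      nlinarith [mul_le_mul_of_nonneg_left h1 (hp0 t a).le, mul_le_mul_of_nonneg_left h2 hε0.le]
    · have hanti : ∀ t ≥ T, ∀ t' ≥ t, x t' a ≤ x t a := fun t ht t' ht' => by
        induction t', ht' using Nat.le_induction with
        | base => exact le_rfl
        | succ t' ht' ih =>
          rw [hx]
          have := mul_nonpos_of_nonneg_of_nonpos (hw t') (mul_nonpos_of_nonneg_of_nonpos
            (hp0 t' a).le (((hT t' (ht.trans ht')).2 a).2.2.1 hlt))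
          linarith
      have hL1 : 0 < 1 - L a := by linarith
      -- When `L a < 0` the advantage is only known to be at least `L a - 1`, so `p a` must be at
      -- most `ε/(1 - L a)` times `p a₀`. The logit of `a` is eventually nonincreasing and unbounded
      -- below, hence reaches the required gap `k` and keeps it.
      set k := Real.log (ε / (1 - L a)) with hk
      have hek : Real.exp k * (1 - L a) = ε := by
        rw [hk, Real.exp_log (div_pos hε0 hL1), div_mul_cancel₀ _ hL1.ne']
      obtain ⟨T', hT', hle⟩ : ∃ t ≥ T, x t a ≤ x T a₀ + k := by
        by_contra! h
        exact hb (bddBelow_range_of_eventually_le (c := x T a₀ + k)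
          ((eventually_ge_atTop T).mono fun t ht => (h t ht).le))
      filter_upwards [eventually_ge_atTop T'] with t ht
      have htT : T ≤ t := hT'.trans ht
      have h1 : p t a ≤ Real.exp k * p t a₀ := hratio t a a₀ k <| by
        linarith [hanti T' hT' t ht, hx₀ t htT]
      have h2 := ((hT t htT).2 a).2.2.2.2
      have h3 := mul_le_mul_of_nonneg_right h1 hL1.le
      have h4 := mul_le_mul_of_nonneg_left h2 (hp0 t a).le
      have h5 : Real.exp k * p t a₀ * (1 - L a) = ε * p t a₀ := by rw [← hek]; ring
      linarith
  set G : Finset A := Finset.univ.filter fun a => L a ≤ 0 ∧ BddBelow (range fun t => x t a) with hG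
  have hGmem : ∀ a, a ∈ G ↔ L a ≤ 0 ∧ BddBelow (range fun t => x t a) := fun a => by simp [hG]
  have hGc : ∀ a, a ∉ G → 0 < L a ∨ (L a ≤ 0 ∧ ¬ BddBelow (range fun t => x t a)) := fun a ha => by
    rw [hGmem] at ha
    by_cases h : L a ≤ 0
    · exact Or.inr ⟨h, fun hb => ha ⟨h, hb⟩⟩
    · exact Or.inl (not_le.1 h)
  have hGsum : ∀ᶠ t in atTop, ∑ a ∈ G, p t a * adv t a ≤ 0 := by
    have hall : ∀ᶠ t in atTop, ∀ a, a ∉ G →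
        (if a = a₀ then Δ / 2 * p t a₀ else 0) - ε * p t a₀ ≤ p t a * adv t a := by
      refine eventually_all.2 fun a => ?_
      by_cases ha : a ∈ G
      · exact Eventually.of_forall fun t h => absurd ha h
      rcases hGc a ha with h | ⟨h, hb⟩
      · filter_upwards [eventually_ge_atTop T] with t ht _
        have h1 := hT t ht
        have h2 := mul_nonneg hε0.le (hp0 t a₀).le
        split_ifs with haa
        · subst haa
          nlinarith [mul_le_mul_of_nonneg_left h1.1 (hp0 t a).le]
        · nlinarith [mul_nonneg (hp0 t a).le ((h1.2 a).1 h)]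
      · filter_upwards [hneg a h hb] with t ht _
        rw [if_neg, zero_sub]
        · exact ht
        · rintro rfl
          exact absurd hpos (not_lt.2 h)
    filter_upwards [hall] with t ht
    have ha₀ : a₀ ∈ Gᶜ := by
      rw [Finset.mem_compl, hGmem]
      exact fun h => absurd hpos (not_lt.2 h.1)
    have h1 : ∑ a ∈ Gᶜ, ((if a = a₀ then Δ / 2 * p t a₀ else 0) - ε * p t a₀) ≤
        ∑ a ∈ Gᶜ, p t a * adv t a :=
      Finset.sum_le_sum fun a ha => ht a (Finset.mem_compl.1 ha)
    rw [Finset.sum_sub_distrib, Finset.sum_ite_eq', if_pos ha₀, Finset.sum_const, nsmul_eq_mul] at h1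
    have h2 : ((Gᶜ.card : ℕ) : ℝ) ≤ Fintype.card A := by exact_mod_cast Finset.card_le_univ _
    have h3 : (Fintype.card A : ℝ) * (ε * p t a₀) = Δ / 2 * p t a₀ := by
      rw [hε]; field_simp
    have h4 := mul_le_mul_of_nonneg_right h2 (mul_nonneg hε0.le (hp0 t a₀).le)
    have h5 := Finset.sum_add_sum_compl G fun a => p t a * adv t a
    rw [hsum] at h5
    linarith
  -- The increment of the summed logits is `w` times the sum of `p adv` over `G`, which is
  -- eventually nonpositive.
  obtain ⟨C, hC⟩ : ∃ C, ∀ᶠ t in atTop, ∑ a ∈ G, x t a ≤ C := by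
    obtain ⟨T', hT'⟩ := eventually_atTop.1 hGsum
    refine ⟨∑ a ∈ G, x T' a, eventually_atTop.2 ⟨T', fun t ht => ?_⟩⟩
    induction t, ht using Nat.le_induction with
    | base => exact le_rfl
    | succ t ht ih =>
      simp only [hx, Finset.sum_add_distrib, ← Finset.mul_sum]
      have := mul_nonpos_of_nonneg_of_nonpos (hw t) (hT' t ht)
      linarith
  choose! c hc using fun a (ha : a ∈ G) => ((hGmem a).1 ha).2
  have hall0 : ∀ a, Tendsto (fun t => p t a) atTop (𝓝 0) := fun a => by
    by_cases ha : a ∈ G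
    · set K := C - ∑ b ∈ G.erase a, c b - x T a₀ with hK
      have h := (hp_lim a₀ hpos.ne').const_mul (Real.exp K)
      rw [mul_zero] at h
      refine squeeze_zero' (Eventually.of_forall fun t => (hp0 t a).le) ?_ h
      filter_upwards [hC, eventually_ge_atTop T] with t ht htT
      refine hratio t a a₀ K ?_
      have h1 : ∑ b ∈ G.erase a, c b ≤ ∑ b ∈ G.erase a, x t b :=
        Finset.sum_le_sum fun b hb => hc b (Finset.mem_of_mem_erase hb) ⟨t, rfl⟩
      have h2 := Finset.add_sum_erase G (fun b => x t b) ha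
      have h3 := hx₀ t htT
      linarith
    · rcases hGc a ha with h | ⟨h, hb⟩
      · exact hp_lim a h.ne'
      · exact squeeze_zero' (Eventually.of_forall fun t => (hp0 t a).le)
          ((hlow a h hb).mono fun t ht => hmono t a a₀ ht) (hp_lim a₀ hpos.ne')
  have h1 : Tendsto (fun t => ∑ a, p t a) atTop (𝓝 (∑ _a : A, (0 : ℝ))) :=
    tendsto_finsetSum _ fun a _ => hall0 a
  have h2 : (fun t => ∑ a, p t a) = fun _ => 1 := funext fun t => by
    simp only [hp, ← Finset.sum_div, div_self (hZ t).ne']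
  rw [h2, Finset.sum_const_zero] at h1
  exact one_ne_zero (tendsto_nhds_unique tendsto_const_nhds h1)

/-! ### Deterministic policies as limits of softmax policies. -/

open Classical in
/-- The deterministic policy that plays `f s` in the state `s`. -/
noncomputable def deterministicPolicy {S A : Type*} [Fintype A] (f : S → A) : StochPolicy S A :=
  fun s => ⟨fun a => if a = f s then 1 else 0,
    fun a => by dsimp only; split_ifs <;> simp,
    (Finset.sum_ite_eq' _ _ _).trans (if_pos (Finset.mem_univ _))⟩

open Classical in
theorem deterministicPolicy_apply {S A : Type*} [Fintype A] (f : S → A) (s : S) (a : A) :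
    deterministicPolicy f s a = if a = f s then 1 else 0 := rfl

theorem stdSimplex_apply_eq_zero_of_eq_one {X : Type*} [Fintype X] (p : stdSimplex ℝ X) {x y : X}
    (hx : p x = 1) (hxy : y ≠ x) : p y = 0 := by
  classical
  have h := Finset.add_sum_erase Finset.univ (fun z => p z) (Finset.mem_univ x)
  rw [stdSimplex_sum_eq_one, hx, add_eq_left] at h
  exact (Finset.sum_eq_zero_iff_of_nonneg fun z _ => stdSimplex_nonneg p z).1 h y
    (Finset.mem_erase.2 ⟨hxy, Finset.mem_univ y⟩)

theorem tendsto_stochPolicy_iff {S A ι : Type*} [Fintype A] {l : Filter ι}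
    {π : ι → StochPolicy S A} {π₀ : StochPolicy S A} :
    Tendsto π l (𝓝 π₀) ↔ ∀ s a, Tendsto (fun i => π i s a) l (𝓝 (π₀ s a)) := by
  rw [tendsto_pi_nhds]
  refine forall_congr' fun s => ?_
  rw [tendsto_subtype_rng, tendsto_pi_nhds]
  rfl

section Softmax

variable {S A : Type*} [Fintype A] [Nonempty A]

theorem softmaxPolicy_ne_of_isDeterministic [Nonempty S] [Nontrivial A] {π : StochPolicy S A}
    (hπ : π.IsDeterministic) (ϑ : EuclideanSpace ℝ (S × A)) : softmaxPolicy ϑ ≠ π := by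
  rintro rfl
  obtain ⟨f, hf⟩ := hπ
  obtain ⟨s⟩ := ‹Nonempty S›
  obtain ⟨a, ha⟩ := exists_ne (f s)
  exact (softmaxPolicy_pos ϑ s a).ne' (stdSimplex_apply_eq_zero_of_eq_one _ (hf s) ha)

theorem softmaxPolicy_le_exp_sub (ϑ : EuclideanSpace ℝ (S × A)) (s : S) (a b : A) :
    softmaxPolicy ϑ s a ≤ Real.exp (ϑ (s, a) - ϑ (s, b)) := by
  rw [Real.exp_sub]
  exact div_le_div_of_nonneg_left (Real.exp_pos _).le (Real.exp_pos _)
    (Finset.single_le_sum (f := fun b => Real.exp (ϑ (s, b)))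
      (fun _ _ => (Real.exp_pos _).le) (Finset.mem_univ b))

theorem exists_tendsto_softmaxPolicy {π : StochPolicy S A} (hπ : π.IsDeterministic) :
    ∃ ϑ : ℕ → EuclideanSpace ℝ (S × A), Tendsto (fun n => softmaxPolicy (ϑ n)) atTop (𝓝 π) := by
  classical
  obtain ⟨f, hf⟩ := hπ
  -- With logit `n` on the chosen action and `0` elsewhere, every other action has probability at
  -- most `exp (-n)`.
  refine ⟨fun n => WithLp.toLp 2 fun x => if x.2 = f x.1 then (n : ℝ) else 0,
    tendsto_stochPolicy_iff.2 fun s => ?_⟩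
  have hne : ∀ a, a ≠ f s → Tendsto (fun n : ℕ => softmaxPolicy (WithLp.toLp 2
      fun x : S × A => if x.2 = f x.1 then (n : ℝ) else 0) s a) atTop (𝓝 0) := fun a ha => by
    refine squeeze_zero (fun n => (softmaxPolicy_pos _ s a).le)
      (fun n => softmaxPolicy_le_exp_sub _ s a (f s)) ?_
    simp only [if_neg ha, if_true, zero_sub]
    exact Real.tendsto_exp_neg_atTop_nhds_zero.comp tendsto_natCast_atTop_atTop
  intro a
  by_cases ha : a = f s
  · subst ha
    have h : Tendsto (fun n : ℕ => 1 - ∑ a ∈ Finset.univ.erase (f s), softmaxPolicy (WithLp.toLp 2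
        fun x : S × A => if x.2 = f x.1 then (n : ℝ) else 0) s a) atTop
        (𝓝 (1 - ∑ _a ∈ Finset.univ.erase (f s), 0)) :=
      tendsto_const_nhds.sub (tendsto_finsetSum _ fun a ha => hne a (Finset.ne_of_mem_erase ha))
    rw [Finset.sum_const_zero, sub_zero] at h
    rw [hf s]
    refine h.congr fun n => ?_
    rw [← stdSimplex_sum_eq_one (softmaxPolicy (WithLp.toLp 2
        fun x : S × A => if x.2 = f x.1 then (n : ℝ) else 0) s),
      ← Finset.add_sum_erase Finset.univ _ (Finset.mem_univ (f s)), add_sub_cancel_right]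
  · rw [stdSimplex_apply_eq_zero_of_eq_one _ (hf s) ha]
    exact hne a ha

/-- Every logit lies in `[-‖ϑ‖, ‖ϑ‖]`, so bounded parameters keep all probabilities away from zero.
-/
theorem exp_neg_norm_le_softmaxPolicy [Fintype S] (ϑ : EuclideanSpace ℝ (S × A)) (s : S) (a : A) :
    Real.exp (-(2 * ‖ϑ‖)) ≤ Fintype.card A * softmaxPolicy ϑ s a := by
  have hle : ∀ x, |ϑ x| ≤ ‖ϑ‖ := fun x => PiLp.norm_apply_le ϑ x
  have hZ : ∑ b, Real.exp (ϑ (s, b)) ≤ Fintype.card A * Real.exp ‖ϑ‖ := by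
    rw [← nsmul_eq_mul]
    exact Finset.sum_le_card_nsmul _ _ _ fun b _ =>
      Real.exp_le_exp.2 ((le_abs_self _).trans (hle _))
  have hZ0 : 0 < ∑ b, Real.exp (ϑ (s, b)) :=
    Finset.sum_pos (fun _ _ => Real.exp_pos _) Finset.univ_nonempty
  change _ ≤ _ * (Real.exp (ϑ (s, a)) / _)
  rw [← mul_div_assoc, le_div_iff₀ hZ0]
  calc Real.exp (-(2 * ‖ϑ‖)) * ∑ b, Real.exp (ϑ (s, b))
      ≤ Real.exp (-(2 * ‖ϑ‖)) * (Fintype.card A * Real.exp ‖ϑ‖) :=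
        mul_le_mul_of_nonneg_left hZ (Real.exp_pos _).le
    _ = Fintype.card A * Real.exp (-‖ϑ‖) := by
        rw [mul_left_comm, ← Real.exp_add]
        congr 2
        ring
    _ ≤ _ := mul_le_mul_of_nonneg_left (Real.exp_le_exp.2 (abs_le.1 (hle _)).1)
        (Nat.cast_nonneg _)

theorem tendsto_norm_atTop_of_tendsto_softmaxPolicy [Fintype S] [Nonempty S] [Nontrivial A]
    {π : StochPolicy S A} (hπ : π.IsDeterministic) {ϑ : ℕ → EuclideanSpace ℝ (S × A)}
    (h : Tendsto (fun n => softmaxPolicy (ϑ n)) atTop (𝓝 π)) :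
    Tendsto (fun n => ‖ϑ n‖) atTop atTop := by
  obtain ⟨f, hf⟩ := hπ
  obtain ⟨s⟩ := ‹Nonempty S›
  obtain ⟨a, ha⟩ := exists_ne (f s)
  have h1 := (tendsto_stochPolicy_iff.1 h s a).const_mul (Fintype.card A : ℝ)
  rw [stdSimplex_apply_eq_zero_of_eq_one _ (hf s) ha, mul_zero] at h1
  have h2 := Real.tendsto_exp_comp_nhds_zero.1 <| squeeze_zero
    (fun n => (Real.exp_pos (-(2 * ‖ϑ n‖))).le)
    (fun n => exp_neg_norm_le_softmaxPolicy (ϑ n) s a) h1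
  exact (tendsto_const_mul_atTop_of_pos two_pos).1 (tendsto_neg_atBot_iff.1 h2)

theorem softmaxPolicy_eq_reweight (θ θ' : EuclideanSpace ℝ (S × A)) (y : A → ℝ) (s : S)
    (h : ∀ a, θ' (s, a) = θ (s, a) + y a) (a : A) :
    softmaxPolicy θ' s a = softmaxPolicy θ s a * Real.exp (y a) /
      ∑ b, softmaxPolicy θ s b * Real.exp (y b) := by
  have hZ : (∑ b, Real.exp (θ (s, b))) ≠ 0 :=
    (Finset.sum_pos (fun _ _ => Real.exp_pos _) Finset.univ_nonempty).ne'
  change Real.exp _ / _ = (Real.exp _ / _) * _ / ∑ b, (Real.exp _ / _) * _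
  simp only [h, Real.exp_add, div_mul_eq_mul_div, ← Finset.sum_div]
  rw [div_div_div_cancel_right₀ hZ]

end Softmax

/-! ### Convergence of the policy gradient iteration. -/

namespace FiniteMDP

variable {S A : Type*} [Fintype S] [Fintype A] [MeasurableSpace S] [DiscreteMeasurableSpace S]
  [MeasurableSpace A] [DiscreteMeasurableSpace A] (M : FiniteMDP S A)

/-- The advantage of the action `a` over the policy `π` in the state `s`. -/
noncomputable def advantage (π : StochPolicy S A) (s : S) (a : A) : ℝ :=
  M.qValue (M.value π) s a - M.value π s

theorem abs_advantage_le (π : StochPolicy S A) (s : S) (a : A) :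
    |M.advantage π s a| ≤ (1 - M.γ)⁻¹ := by
  have h1 := M.qValue_mem_Icc (M.value_mem_Icc π) s a
  have h2 := M.value_mem_Icc π s
  rw [advantage, abs_le]
  constructor <;> linarith [h1.1, h1.2, h2.1, h2.2]

/-- The hypotheses are the Bellman optimality equation. The upper inequality bounds every policy by
`v`; a greedy choice of actions attains it. -/
theorem exists_isDeterministic_value_eq {v : S → ℝ} (hle : ∀ s a, M.qValue v s a ≤ v s)
    (hge : ∀ s, ∃ a, v s ≤ M.qValue v s a) :
    ∃ π : StochPolicy S A, π.IsDeterministic ∧ M.IsOptimal π ∧ ∀ s, M.value π s = v s := by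
  classical
  have hub : ∀ (π : StochPolicy S A) (s : S), M.value π s ≤ v s := fun π =>
    M.value_le_of_qValue_le π fun s => by
      calc _ ≤ ∑ a, π s a * v s := Finset.sum_le_sum fun a _ =>
            mul_le_mul_of_nonneg_left (hle s a) (stdSimplex_nonneg _ a)
        _ = v s := by rw [← Finset.sum_mul, stdSimplex_sum_eq_one, one_mul]
  choose f hf using hge
  have hlb : ∀ s, v s ≤ M.value (deterministicPolicy f) s :=
    M.le_value_of_le_qValue _ fun s => by
      simpa [deterministicPolicy_apply] using hf s
  exact ⟨deterministicPolicy f, ⟨f, fun s => by simp [deterministicPolicy_apply]⟩,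
    fun π s => (hub π s).trans (hlb s), fun s => (hub _ s).antisymm (hlb s)⟩

section PolicyGradient

variable [Nonempty A] {μ : stdSimplex ℝ S} {η : ℝ} {θ : ℕ → EuclideanSpace ℝ (S × A)}

theorem policyGradient_step
    (hθ : ∀ t, θ (t + 1) =
      θ t + η • ∇ (fun ϑ => M.valueFrom (softmaxPolicy ϑ) μ) (θ t))
    (t : ℕ) (s : S) (a : A) :
    θ (t + 1) (s, a) = θ t (s, a) + η * M.occupancy (softmaxPolicy (θ t)) μ s *
      (softmaxPolicy (θ t) s a * M.advantage (softmaxPolicy (θ t)) s a) := by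
  rw [hθ, (M.hasGradientAt_valueFrom_softmaxPolicy μ (θ t)).gradient, mul_assoc]
  rfl

theorem le_expAdvantage_policyGradient_step
    (hθ : ∀ t, θ (t + 1) =
      θ t + η • ∇ (fun ϑ => M.valueFrom (softmaxPolicy ϑ) μ) (θ t))
    (hη : 0 ≤ η) (hη_le : η ≤ (1 - M.γ) ^ 2)
    (t : ℕ) (s : S) :
    η * μ s / 6 * ∑ a, (softmaxPolicy (θ t) s a * M.advantage (softmaxPolicy (θ t)) s a) ^ 2 ≤
      M.expAdvantage (softmaxPolicy (θ t)) (softmaxPolicy (θ (t + 1))) s := by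
  set π := softmaxPolicy (θ t) with hπ
  have hd := M.occupancy_mem_Icc π μ s
  have hd0 : 0 ≤ M.occupancy π μ s := (stdSimplex_nonneg μ s).trans hd.1
  have hγ : 0 < 1 - M.γ := sub_pos.2 M.γ_mem.2
  have h := le_sum_exp_reweight_mul (p := fun a => π s a) (c := M.advantage π s)
    (w := η * M.occupancy π μ s) (stdSimplex_nonneg _) (stdSimplex_sum_eq_one _)
    (M.expAdvantage_self π s) (mul_nonneg hη hd0) (fun a => by
      have hp : |π s a| ≤ 1 := by
        rw [abs_of_nonneg (stdSimplex_nonneg _ a), ← stdSimplex_sum_eq_one (π s)]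
        exact Finset.single_le_sum (f := fun a => π s a) (fun a _ => stdSimplex_nonneg _ a)
          (Finset.mem_univ a)
      rw [abs_mul, abs_mul, abs_mul, abs_of_nonneg hη, abs_of_nonneg hd0]
      -- Occupancy and advantage each cost one factor `1/(1-γ)`, which the step size `(1-γ)²`
      -- absorbs.
      calc η * M.occupancy π μ s * (|π s a| * |M.advantage π s a|)
          ≤ (1 - M.γ) ^ 2 * (1 - M.γ)⁻¹ * (1 * (1 - M.γ)⁻¹) := by
            gcongr
            · exact hd.2
            · exact M.abs_advantage_le π s a
        _ = 1 := by field_simp)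
  refine le_trans ?_ (h.trans_eq (Finset.sum_congr rfl fun a _ => ?_))
  · refine mul_le_mul_of_nonneg_right ?_ (Finset.sum_nonneg fun a _ => sq_nonneg _)
    exact div_le_div_of_nonneg_right (mul_le_mul_of_nonneg_left hd.1 hη) (by norm_num)
  · rw [softmaxPolicy_eq_reweight (θ t) (θ (t + 1)) _ s (M.policyGradient_step hθ t s) a]
    rfl

theorem exists_tendsto_value_policyGradient
    (hθ : ∀ t, θ (t + 1) =
      θ t + η • ∇ (fun ϑ => M.valueFrom (softmaxPolicy ϑ) μ) (θ t))
    (hμ : ∀ s, 0 < μ s) (hη : 0 < η)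
    (hη_le : η ≤ (1 - M.γ) ^ 2) :
    ∃ v : S → ℝ, (∀ s, Tendsto (fun t => M.value (softmaxPolicy (θ t)) s) atTop (𝓝 (v s))) ∧
      (∀ s a, M.qValue v s a ≤ v s) ∧ ∀ s, ∃ a, v s ≤ M.qValue v s a := by
  have hadv := M.le_expAdvantage_policyGradient_step hθ hη.le hη_le
  have hadv0 : ∀ t s, 0 ≤ M.expAdvantage (softmaxPolicy (θ t)) (softmaxPolicy (θ (t + 1))) s :=
    fun t s => le_trans (mul_nonneg (by have := hμ s; positivity)
      (Finset.sum_nonneg fun a _ => sq_nonneg _)) (hadv t s)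
  have hstep : ∀ t s, _ := fun t s => M.value_add_expAdvantage_le _ _ (hadv0 t) s
  have hmono : ∀ s, Monotone fun t => M.value (softmaxPolicy (θ t)) s := fun s =>
    monotone_nat_of_le_succ fun t => by linarith [hstep t s, hadv0 t s]
  have hbdd : ∀ s, BddAbove (range fun t => M.value (softmaxPolicy (θ t)) s) := fun s =>
    ⟨(1 - M.γ)⁻¹, by rintro _ ⟨t, rfl⟩; exact (M.value_mem_Icc _ s).2⟩
  set v : S → ℝ := fun s => ⨆ t, M.value (softmaxPolicy (θ t)) s with hv
  have hlim : ∀ s, Tendsto (fun t => M.value (softmaxPolicy (θ t)) s) atTop (𝓝 (v s)) :=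
    fun s => tendsto_atTop_ciSup (hmono s) (hbdd s)
  have hadv_lim : ∀ s a, Tendsto (fun t => M.advantage (softmaxPolicy (θ t)) s a) atTop
      (𝓝 (M.qValue v s a - v s)) := fun s a =>
    ((tendsto_finsetSum _ fun s' _ => (hlim s').const_mul _).const_mul _ |>.const_add _).sub
      (hlim s)
  have hsum : ∀ s t, ∑ a, softmaxPolicy (θ t) s a * M.advantage (softmaxPolicy (θ t)) s a = 0 :=
    fun s t => M.expAdvantage_self _ s
  -- The squared term is at most a constant times `V_{t+1}(s) - V_t(s)`, which tends to zero; the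
  -- constant is finite because `μ s > 0`.
  have hzero : ∀ s a, Tendsto (fun t => softmaxPolicy (θ t) s a *
      M.advantage (softmaxPolicy (θ t)) s a) atTop (𝓝 0) := fun s a => by
    have hdiff : Tendsto (fun t => (η * μ s / 6)⁻¹ * (M.value (softmaxPolicy (θ (t + 1))) s -
        M.value (softmaxPolicy (θ t)) s)) atTop (𝓝 0) := by
      simpa using (((hlim s).comp (tendsto_add_atTop_nat 1)).sub (hlim s)).const_mul
        (η * μ s / 6)⁻¹
    have hk : 0 < η * μ s / 6 := by have := hμ s; positivity
    have hsq := squeeze_zero (fun t => sq_nonneg (softmaxPolicy (θ t) s a *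
      M.advantage (softmaxPolicy (θ t)) s a)) (fun t => ?_) hdiff
    · refine (tendsto_zero_iff_abs_tendsto_zero _).2 ?_
      simpa [Function.comp_def, Real.sqrt_sq_eq_abs] using hsq.sqrt
    · rw [le_inv_mul_iff₀ hk]
      refine le_trans (mul_le_mul_of_nonneg_left (Finset.single_le_sum (f := fun a =>
        (softmaxPolicy (θ t) s a * M.advantage (softmaxPolicy (θ t)) s a) ^ 2)
        (fun a _ => sq_nonneg _) (Finset.mem_univ a)) hk.le) ?_
      linarith [hadv t s, hstep t s]
  refine ⟨v, hlim, fun s a => sub_nonpos.1 ?_, fun s => ?_⟩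
  · exact limit_advantage_nonpos (x := fun t a => θ t (s, a))
      (w := fun t => η * M.occupancy (softmaxPolicy (θ t)) μ s)
      (p := fun t a => softmaxPolicy (θ t) s a) (fun t a => rfl)
      (fun t => mul_nonneg hη.le ((hμ s).le.trans (M.occupancy_mem_Icc _ μ s).1))
      (fun t a => M.policyGradient_step hθ t s a) (hsum s) (hadv_lim s) (hzero s) a
  -- If all limiting advantages at `s` were negative, then at some time all advantages would be,
  -- contradicting their zero mean under a policy of full support.
  · by_contra! h
    obtain ⟨t, ht⟩ := (eventually_all.2 fun a =>
      (hadv_lim s a).eventually_lt_const (sub_neg.2 (h a))).exists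
    exact (Finset.sum_neg (fun a _ => mul_neg_of_pos_of_neg (softmaxPolicy_pos (θ t) s a) (ht a))
      Finset.univ_nonempty).ne (hsum s t)

end PolicyGradient

end FiniteMDP

theorem mainTheorem2 {S A : Type*} [Fintype S] [Fintype A] [Nonempty A]
    [MeasurableSpace S] [DiscreteMeasurableSpace S]
    [MeasurableSpace A] [DiscreteMeasurableSpace A]
    (M : FiniteMDP S A) (μ : stdSimplex ℝ S) (hμ : ∀ s, 0 < μ s)
    (η : ℝ) (hη_pos : 0 < η) (hη_le : η ≤ (1 - M.γ) ^ 2 / 5)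
    (θ : ℕ → EuclideanSpace ℝ (S × A))
    (hθ : ∀ t, θ (t + 1) = θ t + η • ∇ (fun ϑ => M.valueFrom (softmaxPolicy ϑ) μ) (θ t)) :
    (∃ πs : StochPolicy S A, πs.IsDeterministic ∧ M.IsOptimal πs) ∧
    (∀ πs : StochPolicy S A, M.IsOptimal πs → ∀ s : S,
      Tendsto (fun t => M.value (softmaxPolicy (θ t)) s) atTop (𝓝 (M.value πs s))) ∧
    (Nontrivial A → ∀ πs : StochPolicy S A, πs.IsDeterministic → M.IsOptimal πs →
      (∀ ϑ : EuclideanSpace ℝ (S × A), softmaxPolicy ϑ ≠ πs) ∧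
      (∃ ϑ : ℕ → EuclideanSpace ℝ (S × A),
        Tendsto (fun n => softmaxPolicy (ϑ n)) atTop (𝓝 πs)) ∧
      (∀ ϑ : ℕ → EuclideanSpace ℝ (S × A),
        Tendsto (fun n => softmaxPolicy (ϑ n)) atTop (𝓝 πs) →
        Tendsto (fun n => ‖ϑ n‖) atTop atTop)) := by
  have hη_le' : η ≤ (1 - M.γ) ^ 2 := hη_le.trans (div_le_self (sq_nonneg _) (by norm_num))
  have : Nonempty S := by
    by_contra h
    rw [not_nonempty_iff] at h
    simpa using stdSimplex_sum_eq_one μ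
  obtain ⟨v, hlim, hle, hge⟩ := M.exists_tendsto_value_policyGradient hθ hμ hη_pos hη_le'
  obtain ⟨π₀, hdet, hopt, hval⟩ := M.exists_isDeterministic_value_eq hle hge
  refine ⟨⟨π₀, hdet, hopt⟩, fun πs hπs s => ?_, fun _ πs hπs _ => ⟨?_, ?_, ?_⟩⟩
  · rw [(hopt πs s).antisymm (hπs π₀ s), hval]
    exact hlim s
  · exact softmaxPolicy_ne_of_isDeterministic hπs
  · exact exists_tendsto_softmaxPolicy hπs
  · exact fun ϑ => tendsto_norm_atTop_of_tendsto_softmaxPolicy hπs
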